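/- Let $\mathcal{A}$ be an abelian category with enough projective and enough injective objects. For a class $\mathcal{C}$ of objects put ${}^{\perp}\mathcal{C}=\{M\mid \mathrm{Ext}^1_{\mathcal{A}}(M,C)=0\ \forall C\in\mathcal{C}\}$ and $\mathcal{C}^{\perp}=\{M\mid \mathrm{Ext}^1_{\mathcal{A}}(C,M)=0\ \forall C\in\mathcal{C}\}$. A pair $(\mathcal{P},\mathcal{Q})$ of full subcategories is a cotorsion pair if $\mathcal{P}={}^{\perp}\mathcal{Q}$ and $\mathcal{Q}=\mathcal{P}^{\perp}$. It is complete if every object $M$ admits short exact sequences $0\to Q\to P\to M\to 0$ and $0\to M\to Q'\to P'\to 0$ with $P,P'\in\mathcal{P}$ and $Q,Q'\in\mathcal{Q}$. It is hereditary if $\mathcal{P}$ is resolving, i.e. $\mathcal{P}$ contains all projective objects and, for every short exact sequence $0\to P_1\to P_2\to P_3\to 0$ with $P_3\in\mathcal{P}$, one has $P_2\in\mathcal{P}$ if and only if $P_1\in\mathcal{P}$. Let $(\mathcal{X},\mathcal{Z},\mathcal{Y})$ be a complete and hereditary cotorsion triple in $\mathcal{A}$, i.e. $(\mathcal{X},\mathcal{Z})$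 and $(\mathcal{Z},\mathcal{Y})$ are both complete and hereditary cotorsion pairs. An $\mathcal{X}$-resolution of an object $M$ is a complex $\cdots\to X_1\to X_0\to M\to 0$ with all $X_i\in\mathcal{X}$ that becomes exact after applying $\mathrm{Hom}_{\mathcal{A}}(X,-)$ for every $X\in\mathcal{X}$. A $\mathcal{Y}$-coresolution of an object $N$ is a complex $0\to N\to Y^0\to Y^1\to\cdots$ with all $Y^i\in\mathcal{Y}$ that becomes exact after applying $\mathrm{Hom}_{\mathcal{A}}(-,Y)$ for every $Y\in\mathcal{Y}$. Every object $M$ has an $\mathcal{X}$-resolution, and one puts $\mathrm{Ext}^i_{\mathcal{XY}}(M,N):=H^i\,\mathrm{Hom}_{\mathcal{A}}(\mathbf{X}^{\bullet},N)$, where $\mathbf{X}^{\bullet}=(\cdots\to X_1\to X_0\to 0)$ comes from an $\mathcal{X}$-resolution of $M$; up to isomorphism this does not depend on the choice. Finally, $\mathcal{Z}\text{-}\mathrm{id}(N)$ is the smallest integer $m\ge 0$ such that $\mathrm{Ext}^{m+i}_{\mathcal{A}}(Z,N)=0$ for all $Z\in\mathcal{Z}$ and $i\ge 1$, and $\infty$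 if there is no such $m$. Then for any object $N\in\mathcal{A}$ and any integer $n\ge 0$ the following are equivalent: (1) $\mathcal{Z}\text{-}\mathrm{id}(N)\le n$. (2) $\mathrm{Ext}^{n+i}_{\mathcal{A}}(Z,N)=0$ for all $Z\in\mathcal{Z}$ and $i\ge 1$. (3) $\mathrm{Ext}^{n+i}_{\mathcal{XY}}(M,N)=0$ for all $M\in\mathcal{A}$ and $i\ge 1$. (4) For every $\mathcal{Y}$-coresolution $0\to N\to Y^0\to Y^1\to\cdots$ of $N$, the $n$-th cokernel $L^n$ lies in $\mathcal{Y}$. (5) For every exact sequence $0\to N\to Y^0\to Y^1\to\cdots$ with all $Y^i\in\mathcal{Y}$, the $n$-th cokernel $L^n$ lies in $\mathcal{Y}$. Here $L^0=N$, $L^1=\mathrm{Coker}(N\to Y^0)$, and $L^n=\mathrm{Coker}(Y^{n-2}\to Y^{n-1})$ for $n\ge 2$. -/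

import Mathlib

open CategoryTheory CategoryTheory.Limits CategoryTheory.Abelian

universe w v u

namespace CotorsionTriple

section Cotorsion

variable {A : Type u} [Category.{v} A] [Abelian A]

/-- The left orthogonal class: all `M` with `Ext¹(M, C) = 0` for every `C` in `P`. -/
def leftPerp [HasExt.{w} A] (P : ObjectProperty A) : ObjectProperty A :=
  fun M => ∀ C : A, P C → Subsingleton (Ext.{w} M C 1)

/-- The right orthogonal class: all `M` with `Ext¹(C, M) = 0` for every `C` in `P`. -/
def rightPerp [HasExt.{w} A] (P : ObjectProperty A) : ObjectProperty A :=
  fun M => ∀ C : A, P C → Subsingleton (Ext.{w} C M 1)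

/-- `(P, Q)` is a cotorsion pair: each of the two classes is the `Ext¹`-orthogonal of the other. -/
structure IsCotorsionPair [HasExt.{w} A] (P Q : ObjectProperty A) : Prop where
  left_eq : P = leftPerp.{w} Q
  right_eq : Q = rightPerp.{w} P

/-- Completeness of a pair `(P, Q)`: every object `M` admits short exact sequences
`0 → Q₀ → P₀ → M → 0` and `0 → M → Q₁ → P₁ → 0` with `P₀, P₁` in `P` and `Q₀, Q₁` in `Q`. -/
structure IsCompletePair (P Q : ObjectProperty A) : Prop where
  exists_left (M : A) : ∃ (Q₀ P₀ : A) (f : Q₀ ⟶ P₀) (g : P₀ ⟶ M) (zero : f ≫ g = 0),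
    P P₀ ∧ Q Q₀ ∧ (ShortComplex.mk f g zero).ShortExact
  exists_right (M : A) : ∃ (Q₁ P₁ : A) (f : M ⟶ Q₁) (g : Q₁ ⟶ P₁) (zero : f ≫ g = 0),
    P P₁ ∧ Q Q₁ ∧ (ShortComplex.mk f g zero).ShortExact

/-- `P` is resolving: it contains all projective objects and, for every short exact sequence
`0 → X₁ → X₂ → X₃ → 0` with `X₃` in `P`, one has `X₂` in `P` if and only if `X₁` in `P`. -/
structure IsResolving (P : ObjectProperty A) : Prop where
  projective (M : A) : Projective M → P M
  mem_iff (S : ShortComplex A) : S.ShortExact → P S.X₃ → (P S.X₂ ↔ P S.X₁)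

/-- `(X, Z, Y)` is a cotorsion triple: `(X, Z)` and `(Z, Y)` are cotorsion pairs. -/
structure IsCotorsionTriple [HasExt.{w} A] (X Z Y : ObjectProperty A) : Prop where
  left : IsCotorsionPair.{w} X Z
  right : IsCotorsionPair.{w} Z Y

/-- A cotorsion triple is complete if both of its cotorsion pairs are complete, and hereditary if
both of its cotorsion pairs are, that is, if their left-hand classes are resolving. -/
structure IsCompleteHereditaryCotorsionTriple [HasExt.{w} A] (X Z Y : ObjectProperty A) : Prop
    extends IsCotorsionTriple.{w} X Z Y where
  complete_left : IsCompletePair X Z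
  complete_right : IsCompletePair Z Y
  hereditary_left : IsResolving X
  hereditary_right : IsResolving Z

/-- The `C`-injective dimension of `N`: the least `m : ℕ` with `Ext^{m+i}(C', N) = 0` for all `C'`
in `C` and all `i ≥ 1`, and `⊤` if there is no such `m`. -/
noncomputable def relInjDim [HasExt.{w} A] (C : ObjectProperty A) (N : A) : ℕ∞ :=
  sInf {d : ℕ∞ | ∃ m : ℕ, d = m ∧
    ∀ (C' : A) (i : ℕ), C C' → 1 ≤ i → Subsingleton (Ext.{w} C' N (m + i))}

end Cotorsion

section Resolutions

variable {A : Type u} [Category.{v} A] [Abelian A]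

/-- The complex of abelian groups `Hom(X, K)`, for a complex `K`. -/
noncomputable def homTo {ι : Type} {c : ComplexShape ι} (X : A) (K : HomologicalComplex A c) :
    HomologicalComplex AddCommGrpCat.{v} c :=
  ((preadditiveCoyoneda.obj (Opposite.op X)).mapHomologicalComplex c).obj K

/-- The complex of abelian groups `Hom(K, Y)`, for a complex `K`; its arrows are reversed. -/
noncomputable def homFrom {ι : Type} {c : ComplexShape ι} (K : HomologicalComplex A c) (Y : A) :
    HomologicalComplex AddCommGrpCat.{v} c.symm :=
  ((preadditiveYoneda.obj Y).mapHomologicalComplex c.symm).obj K.op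

/-- A complex `⋯ → X₁ → X₀ → M → 0`. -/
structure LeftAugmented (M : A) where
  /-- the deleted complex `⋯ → X₁ → X₀ → 0` -/
  complex : ChainComplex A ℕ
  /-- the augmentation `X₀ → M` -/
  π : complex.X 0 ⟶ M
  zero : complex.d 1 0 ≫ π = 0

/-- The whole complex `⋯ → X₁ → X₀ → M → 0`, with `M` in degree `0` and `Xᵢ` in degree `i + 1`. -/
noncomputable def LeftAugmented.augmented {M : A} (E : LeftAugmented M) : ChainComplex A ℕ :=
  E.complex.augment E.π E.zero

/-- A complex `0 → N → Y⁰ → Y¹ → ⋯`. -/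
structure RightAugmented (N : A) where
  /-- the deleted complex `0 → Y⁰ → Y¹ → ⋯` -/
  complex : CochainComplex A ℕ
  /-- the augmentation `N → Y⁰` -/
  ι : N ⟶ complex.X 0
  zero : ι ≫ complex.d 0 1 = 0

/-- The whole complex `0 → N → Y⁰ → Y¹ → ⋯`, with `N` in degree `0` and `Yⁱ` in degree `i + 1`. -/
noncomputable def RightAugmented.augmented {N : A} (E : RightAugmented N) : CochainComplex A ℕ :=
  E.complex.augment E.ι E.zero

/-- The `n`-th cokernel `Lⁿ` of `0 → N → Y⁰ → Y¹ → ⋯`: it is `L⁰ = N`, `L¹ = Coker (N → Y⁰)` and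
`Lⁿ = Coker (Yⁿ⁻² → Yⁿ⁻¹)` for `n ≥ 2`. -/
noncomputable def RightAugmented.nthCokernel {N : A} (E : RightAugmented N) : ℕ → A
  | 0 => N
  | 1 => cokernel E.ι
  | n + 2 => cokernel (E.complex.d n (n + 1))

/-- `⋯ → X₁ → X₀ → M → 0` is a `P`-resolution of `M`: all `Xᵢ` lie in `P`, and the complex becomes
exact after applying `Hom(X', -)` for every `X'` in `P`. -/
structure LeftAugmented.IsResolution (P : ObjectProperty A) {M : A} (E : LeftAugmented M) :
    Prop where
  mem (i : ℕ) : P (E.complex.X i)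
  exact (X' : A) : P X' → (homTo X' E.augmented).Acyclic

/-- `0 → N → Y⁰ → Y¹ → ⋯` is a `P`-coresolution of `N`: all `Yⁱ` lie in `P`, and the complex becomes
exact after applying `Hom(-, Y')` for every `Y'` in `P`. -/
structure RightAugmented.IsCoresolution (P : ObjectProperty A) {N : A} (E : RightAugmented N) :
    Prop where
  mem (i : ℕ) : P (E.complex.X i)
  exact (Y' : A) : P Y' → (homFrom E.augmented Y').Acyclic

/-- Exactness of `Hom(X, K)` in terms of morphisms. -/
lemma homTo_acyclic (X : A) (K : ChainComplex A ℕ)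
    (h0 : ∀ f : X ⟶ K.X 0, ∃ g : X ⟶ K.X 1, g ≫ K.d 1 0 = f)
    (h1 : ∀ (n : ℕ) (f : X ⟶ K.X (n + 1)), f ≫ K.d (n + 1) n = 0 →
      ∃ g : X ⟶ K.X (n + 2), g ≫ K.d (n + 2) (n + 1) = f) :
    (homTo X K).Acyclic := by
  intro i
  cases i with
  | zero =>
    rw [HomologicalComplex.exactAt_iff' _ 1 0 0 (by simp) (by simp), ShortComplex.ab_exact_iff]
    intro f _
    exact h0 f
  | succ n =>
    rw [HomologicalComplex.exactAt_iff' _ (n + 2) (n + 1) n (by simp) (by simp),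
      ShortComplex.ab_exact_iff]
    intro f hf
    exact h1 n f hf

section Existence

variable (app : A → A) (g : ∀ M : A, app M ⟶ M)

/-- The iterated kernels of chosen morphisms `g M : app M ⟶ M`. -/
noncomputable def syz (M : A) : ℕ → A
  | 0 => M
  | n + 1 => kernel (g (syz M n))

/-- The inclusion of the next iterated kernel. -/
noncomputable def syzι (M : A) (n : ℕ) : syz app g M (n + 1) ⟶ app (syz app g M n) :=
  kernel.ι (g (syz app g M n))

lemma syzι_comp (M : A) (n : ℕ) : syzι app g M n ≫ g (syz app g M n) = 0 :=
  kernel.condition _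

lemma syzι_cancel (M : A) (n : ℕ) {B : A} (f : B ⟶ syz app g M (n + 1))
    (hf : f ≫ syzι app g M n = 0) : f = 0 :=
  (cancel_mono (kernel.ι (g (syz app g M n)))).1 (hf.trans zero_comp.symm)

lemma exists_lift_syz (M : A) (n : ℕ) {B : A} (f : B ⟶ app (syz app g M n))
    (hf : f ≫ g (syz app g M n) = 0) : ∃ l : B ⟶ syz app g M (n + 1), l ≫ syzι app g M n = f :=
  ⟨kernel.lift _ f hf, kernel.lift_ι _ f hf⟩

/-- The complex obtained by splicing chosen morphisms `g M : app M ⟶ M` along their kernels. -/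
noncomputable def splice (M : A) : LeftAugmented M where
  complex := ChainComplex.of (fun n => app (syz app g M n))
    (fun n => g (syz app g M (n + 1)) ≫ syzι app g M n)
    (fun n => by
      rw [Category.assoc, ← Category.assoc (syzι app g M (n + 1)), syzι_comp, zero_comp, comp_zero])
  π := g M
  zero := by
    have h := ChainComplex.of_d (fun n => app (syz app g M n))
      (fun n => g (syz app g M (n + 1)) ≫ syzι app g M n) 0
    refine (congrArg (fun t => t ≫ g (syz app g M 0)) h).trans ?_
    change (g (syz app g M 1) ≫ syzι app g M 0) ≫ g (syz app g M 0) = 0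
    rw [Category.assoc, syzι_comp, comp_zero]

lemma splice_d (M : A) (n : ℕ) :
    (splice app g M).complex.d (n + 1) n = g (syz app g M (n + 1)) ≫ syzι app g M n :=
  ChainComplex.of_d (fun n => app (syz app g M n))
    (fun n => g (syz app g M (n + 1)) ≫ syzι app g M n) n

lemma splice_exact (M X : A) (h : ∀ (B : A) (f : X ⟶ B), ∃ l : X ⟶ app B, l ≫ g B = f) :
    (homTo X (splice app g M).augmented).Acyclic := by
  -- lifting of cycles along the differentials of the spliced complex
  have key (n : ℕ) (f : X ⟶ app (syz app g M n)) (hf : f ≫ g (syz app g M n) = 0) :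
      ∃ l : X ⟶ (splice app g M).complex.X (n + 1),
        l ≫ (splice app g M).complex.d (n + 1) n = f := by
    obtain ⟨k, hk⟩ := exists_lift_syz app g M n f hf
    obtain ⟨l, hl⟩ := h _ k
    refine ⟨l, (congrArg (fun t => l ≫ t) (splice_d app g M n)).trans ?_⟩
    change l ≫ g (syz app g M (n + 1)) ≫ syzι app g M n = f
    rw [← Category.assoc, hl, hk]
  refine homTo_acyclic _ _ (h M) ?_
  intro n
  cases n with
  | zero =>
    intro f hf
    exact key 0 f hf
  | succ n =>
    intro f hf
    change X ⟶ app (syz app g M (n + 1)) at f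
    have hf' : f ≫ g (syz app g M (n + 1)) ≫ syzι app g M n = 0 :=
      (congrArg (fun t => (show X ⟶ (splice app g M).complex.X (n + 1) from f) ≫ t)
        (splice_d app g M n)).symm.trans hf
    exact key (n + 1) f (syzι_cancel app g M n _ ((Category.assoc _ _ _).trans hf'))

end Existence

/-- For a complete cotorsion pair `(P, Q)`, every object has a `P`-resolution. -/
theorem exists_resolution [HasExt.{w} A] {P Q : ObjectProperty A} (h : IsCotorsionPair.{w} P Q)
    (hc : IsCompletePair P Q) (M : A) : ∃ E : LeftAugmented M, E.IsResolution P := by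
  choose K app f g zero hP hQ hS using hc.exists_left
  refine ⟨splice app g M, fun i => hP _, fun X hX => splice_exact app g M X fun B t => ?_⟩
  have : Subsingleton (Ext.{w} X (K B) 1) := by
    rw [h.left_eq] at hX
    exact hX _ (hQ B)
  obtain ⟨x, hx⟩ := Ext.covariant_sequence_exact₃ X (hS B) (Ext.mk₀ t) (zero_add 1)
    (Subsingleton.elim (α := Ext.{w} X (K B) 1) _ _)
  obtain ⟨l, rfl⟩ := (Ext.mk₀_bijective X (app B)).2 x
  exact ⟨l, (Ext.mk₀_bijective X B).1 (by simpa using hx)⟩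

/-- The relative extension group `Ext^i_{XY}(M, N) = Hⁱ Hom(X•, N)`, where `X• → M` is a (chosen)
`X`-resolution of `M`; it does not depend on the choice up to isomorphism. -/
noncomputable def relExt [HasExt.{w} A] {X Z Y : ObjectProperty A}
    (h : IsCompleteHereditaryCotorsionTriple.{w} X Z Y) (M N : A) (i : ℕ) : AddCommGrpCat.{v} :=
  (homFrom (exists_resolution h.left h.complete_left M).choose.complex N).homology i

end Resolutions

end CotorsionTriple

/-! Dimension shifting reduces everything to `n = 0`, where both families of extension groups detect
membership in `Y`.

Let `N` be in `Y`, and let `0 → K → B → M → 0` be exact with `B` in `X` and `K` in `Z`. Embed `K` in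
an injective `I`. Since `(X, Z)` is hereditary, `I/K` is in `Z`, so a map `K ⟶ N` extends to `I` and
hence to `B`. A Schanuel-type comparison (`IsPrecoverSequence.exists_extension`) passes this to
every `X`-precover, so relative Ext into `N` vanishes in positive degrees (`homFrom_exactAt`).
Conversely, if `M` is in `Z`, a projective presentation of `M` has kernel in `Z`, so it is an
`X`-precover. The same comparison then turns vanishing of the first relative Ext into `Ext¹(M, N) =
0` (`subsingleton_ext_one`).

For larger `n`, use `0 → N → I → L → 0` with `I` in `Y` and `L` in `Z`. It stays exact under `Hom(B,
-)` for `B` in `X`, so both theories shift along it (`forall_exactAt_iff`).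

The conditions on cokernels follow by shifting absolute Ext along `0 → Lʲ → Yʲ → Lʲ⁺¹ → 0`
(`nthCokernel_mem_iff`). -/

namespace CotorsionTriple

/-! ### Testing exactness against projectives and injectives -/

section Exactness

variable {A : Type u} [Category.{v} A] [Abelian A]

/-- Every object is a quotient of a projective one. -/
lemma exists_shortExact_projective [EnoughProjectives A] (M : A) :
    ∃ S : ShortComplex A, S.ShortExact ∧ Projective S.X₂ ∧ S.X₃ = M :=
  ⟨ShortComplex.mk (kernel.ι (Projective.π M)) (Projective.π M) (kernel.condition _),
    { exact := ShortComplex.exact_kernel _ }, inferInstanceAs (Projective (Projective.over M)), rfl⟩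

lemma homTo_exactAt_iff {ι : Type} {c : ComplexShape ι} (X : A) (K : HomologicalComplex A c)
    (i j k : ι) (hi : c.prev j = i) (hk : c.next j = k) :
    (homTo X K).ExactAt j ↔ ∀ f : X ⟶ K.X j, f ≫ K.d j k = 0 →
      ∃ g : X ⟶ K.X i, g ≫ K.d i j = f := by
  rw [HomologicalComplex.exactAt_iff' _ i j k hi hk, ShortComplex.ab_exact_iff]
  rfl

lemma homFrom_exactAt_iff {ι : Type} {c : ComplexShape ι} (K : HomologicalComplex A c) (Y : A)
    (i j k : ι) (hi : c.prev j = i) (hk : c.next j = k) :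
    (homFrom K Y).ExactAt j ↔ ∀ f : K.X j ⟶ Y, K.d i j ≫ f = 0 →
      ∃ g : K.X k ⟶ Y, K.d j k ≫ g = f := by
  rw [HomologicalComplex.exactAt_iff' (homFrom K Y) k j i hk hi,
    ShortComplex.ab_exact_iff]
  rfl

/-- A complex is exact where `Hom(P, -)` is exact for all projective objects `P`. -/
lemma exactAt_of_homTo [EnoughProjectives A] {ι : Type} {c : ComplexShape ι}
    (K : HomologicalComplex A c) (j : ι)
    (h : ∀ P : A, Projective P → (homTo P K).ExactAt j) : K.ExactAt j := by
  rw [HomologicalComplex.exactAt_iff_exact_up_to_refinements _ _ j _ rfl rfl]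
  intro B f hf
  obtain ⟨g, hg⟩ := (homTo_exactAt_iff _ K _ j _ rfl rfl).1
    (h (Projective.over B) inferInstance) (Projective.π B ≫ f) (by simp [hf])
  exact ⟨_, Projective.π B, inferInstance, g, hg.symm⟩

/-- A short complex is exact if `Hom(-, J)` is exact on it for all injective objects `J`. -/
lemma exact_of_extension_injective [EnoughInjectives A] (S : ShortComplex A)
    (h : ∀ (J : A) (f : S.X₂ ⟶ J), Injective J → S.f ≫ f = 0 → ∃ g : S.X₃ ⟶ J, S.g ≫ g = f) :
    S.Exact := by
  rw [ShortComplex.exact_iff_mono_cokernel_desc]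
  -- One test map suffices: embedding the cokernel of `S.f` in an injective forces the comparison
  -- map to be mono.
  obtain ⟨g, hg⟩ := h (Injective.under (cokernel S.f)) (cokernel.π S.f ≫ Injective.ι _)
    inferInstance (by simp)
  have : cokernel.desc S.f S.g S.zero ≫ g = Injective.ι _ := by
    rw [← cancel_epi (cokernel.π S.f), cokernel.π_desc_assoc, hg]
  exact mono_of_mono_fac this

/-- A complex is exact where `Hom(-, J)` is exact for all injective objects `J`. -/
lemma exactAt_of_homFrom [EnoughInjectives A] {ι : Type} {c : ComplexShape ι}
    (K : HomologicalComplex A c) (j : ι)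
    (h : ∀ J : A, Injective J → (homFrom K J).ExactAt j) : K.ExactAt j := by
  rw [HomologicalComplex.exactAt_iff' _ _ j _ rfl rfl]
  exact exact_of_extension_injective _ fun J f hJ hf =>
    (homFrom_exactAt_iff K J _ j _ rfl rfl).1 (h J hJ) f hf

end Exactness

/-! ### Ext-orthogonality and hereditary cotorsion pairs -/

section Orthogonality

variable {A : Type u} [Category.{v} A] [Abelian A] [HasExt.{w} A]

/-- If `Ext¹(S.X₃, N) = 0`, morphisms to `N` extend along `S.f`. -/
lemma exists_extension {S : ShortComplex A} (hS : S.ShortExact) {N : A}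
    (h : Subsingleton (Ext.{w} S.X₃ N 1)) (φ : S.X₁ ⟶ N) : ∃ ψ : S.X₂ ⟶ N, S.f ≫ ψ = φ := by
  obtain ⟨x, hx⟩ := Ext.contravariant_sequence_exact₁ hS N (Ext.mk₀ φ) (add_zero 1)
    (Subsingleton.elim _ _)
  obtain ⟨l, rfl⟩ := (Ext.mk₀_bijective _ _).2 x
  exact ⟨l, (Ext.mk₀_bijective _ _).1 (by simpa using hx)⟩

/-- If `Ext¹(M, S.X₁) = 0`, morphisms from `M` lift along `S.g`. -/
lemma exists_lifting {S : ShortComplex A} (hS : S.ShortExact) {M : A}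
    (h : Subsingleton (Ext.{w} M S.X₁ 1)) (φ : M ⟶ S.X₃) : ∃ ψ : M ⟶ S.X₂, ψ ≫ S.g = φ := by
  obtain ⟨x, hx⟩ := Ext.covariant_sequence_exact₃ M hS (Ext.mk₀ φ) (zero_add 1)
    (Subsingleton.elim _ _)
  obtain ⟨l, rfl⟩ := (Ext.mk₀_bijective _ _).2 x
  exact ⟨l, (Ext.mk₀_bijective _ _).1 (by simpa using hx)⟩

/-- If `Ext¹(S.X₂, N) = 0` and morphisms to `N` extend along `S.f`, then `Ext¹(S.X₃, N) = 0`. -/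
lemma subsingleton_ext_one_of_extension {S : ShortComplex A} (hS : S.ShortExact) {N : A}
    (h : Subsingleton (Ext.{w} S.X₂ N 1)) (hN : ∀ φ : S.X₁ ⟶ N, ∃ ψ : S.X₂ ⟶ N, S.f ≫ ψ = φ) :
    Subsingleton (Ext.{w} S.X₃ N 1) := by
  refine subsingleton_of_forall_eq 0 fun x => ?_
  obtain ⟨y, rfl⟩ := Ext.contravariant_sequence_exact₃ hS N x (Subsingleton.elim _ _) (add_zero 1)
  obtain ⟨φ, rfl⟩ := (Ext.mk₀_bijective _ _).2 y
  obtain ⟨ψ, rfl⟩ := hN φ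
  rw [← Ext.mk₀_comp_mk₀]
  -- The extension class of `S` is killed by `S.f`, through which the map now factors.
  exact hS.extClass_comp_assoc _

/-- Dimension shifting in the second variable. -/
lemma subsingleton_ext_iff_of_shortExact {S : ShortComplex A} (hS : S.ShortExact) (M : A) (i : ℕ)
    (h₀ : Subsingleton (Ext.{w} M S.X₂ i)) (h₁ : Subsingleton (Ext.{w} M S.X₂ (i + 1))) :
    Subsingleton (Ext.{w} M S.X₃ i) ↔ Subsingleton (Ext.{w} M S.X₁ (i + 1)) := by
  constructor <;> intro h
  · refine subsingleton_of_forall_eq 0 fun x => ?_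
    obtain ⟨y, rfl⟩ := Ext.covariant_sequence_exact₁ M hS x (Subsingleton.elim _ _) rfl
    rw [Subsingleton.elim y 0, Ext.zero_comp]
  · refine subsingleton_of_forall_eq 0 fun x => ?_
    obtain ⟨y, rfl⟩ := Ext.covariant_sequence_exact₃ M hS x rfl (Subsingleton.elim _ _)
    rw [Subsingleton.elim y 0, Ext.zero_comp]

variable {P Q : ObjectProperty A}

lemma IsCotorsionPair.subsingleton (h : IsCotorsionPair.{w} P Q) {M N : A} (hM : P M) (hN : Q N) :
    Subsingleton (Ext.{w} M N 1) := by
  rw [h.left_eq] at hM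
  exact hM _ hN

lemma IsCotorsionPair.right_of_injective (h : IsCotorsionPair.{w} P Q) (J : A) [Injective J] :
    Q J := by
  rw [h.right_eq]
  intro C _
  exact subsingleton_of_forall_eq 0 Ext.eq_zero_of_injective

variable [EnoughProjectives A]

/-- For a hereditary cotorsion pair `(P, Q)`, all higher extensions of `P` by `Q` vanish. -/
lemma IsCotorsionPair.subsingleton_succ (h : IsCotorsionPair.{w} P Q) (hP : IsResolving P)
    {M N : A} (hM : P M) (hN : Q N) (i : ℕ) : Subsingleton (Ext.{w} M N (i + 1)) := by
  induction i generalizing M with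
  | zero => exact h.subsingleton hM hN
  | succ i ih =>
    obtain ⟨S, hS, hproj, rfl⟩ := exists_shortExact_projective M
    have hS₁ : P S.X₁ := (hP.mem_iff S hS hM).1 (hP.projective _ hproj)
    have := ih hS₁
    refine subsingleton_of_forall_eq 0 fun x => ?_
    obtain ⟨y, rfl⟩ := Ext.contravariant_sequence_exact₃ hS N x (Ext.eq_zero_of_projective _)
      (add_comm 1 (i + 1))
    rw [Subsingleton.elim y 0, Ext.comp_zero]

/-- For a hereditary cotorsion pair `(P, Q)`, the class `Q` is closed under cokernels of
monomorphisms. -/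
lemma IsCotorsionPair.right_of_shortExact (h : IsCotorsionPair.{w} P Q) (hP : IsResolving P)
    {S : ShortComplex A} (hS : S.ShortExact) (h₁ : Q S.X₁) (h₂ : Q S.X₂) : Q S.X₃ := by
  rw [h.right_eq]
  intro C hC
  -- Heredity enters through `Ext²(C, S.X₁) = 0`, which bounds `Ext¹(C, S.X₃)`.
  exact (subsingleton_ext_iff_of_shortExact hS C 1 (h.subsingleton hC h₂)
    (h.subsingleton_succ hP hC h₂ 1)).2 (h.subsingleton_succ hP hC h₁ 1)

end Orthogonality

/-! ### Comparison of precovers -/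

section Precovers

variable {A : Type u} [Category.{v} A] [Abelian A]

/-- `0 → S.X₁ → S.X₂ → S.X₃ → 0` is a short exact sequence whose epimorphism is a `P`-precover. -/
structure IsPrecoverSequence (P : ObjectProperty A) (S : ShortComplex A) : Prop where
  shortExact : S.ShortExact
  mem : P S.X₂
  exists_lift {X : A} (hX : P X) (f : X ⟶ S.X₃) : ∃ g : X ⟶ S.X₂, g ≫ S.g = f

/-- Extendability of morphisms from the kernel of a `P`-precover depends only on the covered
object. -/
lemma IsPrecoverSequence.exists_extension {P : ObjectProperty A} {S T : ShortComplex A}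
    (hS : IsPrecoverSequence P S) (hT : IsPrecoverSequence P T) (e : S.X₃ ≅ T.X₃) {N : A}
    (h : ∀ φ : T.X₁ ⟶ N, ∃ ψ : T.X₂ ⟶ N, T.f ≫ ψ = φ) (φ : S.X₁ ⟶ N) :
    ∃ ψ : S.X₂ ⟶ N, S.f ≫ ψ = φ := by
  have := hS.shortExact.mono_f
  have := hT.shortExact.mono_f
  obtain ⟨f, hf⟩ := hT.exists_lift hS.mem (S.g ≫ e.hom)
  obtain ⟨g, hg⟩ := hS.exists_lift hT.mem (T.g ≫ e.inv)
  let k : S.X₁ ⟶ T.X₁ := hT.shortExact.exact.lift (S.f ≫ f) (by simp [hf])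
  let k' : T.X₁ ⟶ S.X₁ := hS.shortExact.exact.lift (T.f ≫ g) (by simp [hg])
  -- The round trip `f ≫ g` covers the identity of `S.X₃`, so its defect lands in the kernel and
  -- gives a contracting homotopy.
  let s : S.X₂ ⟶ S.X₁ := hS.shortExact.exact.lift (𝟙 _ - f ≫ g) (by
    simp [hg, reassoc_of% hf])
  have hk : k ≫ T.f = S.f ≫ f := hT.shortExact.exact.lift_f _ _
  have hk' : k' ≫ S.f = T.f ≫ g := hS.shortExact.exact.lift_f _ _
  have hs : s ≫ S.f = 𝟙 _ - f ≫ g := hS.shortExact.exact.lift_f _ _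
  have homotopy : S.f ≫ s + k ≫ k' = 𝟙 _ := by
    rw [← cancel_mono S.f]
    simp [hs, hk', reassoc_of% hk]
  obtain ⟨ψ, hψ⟩ := h (k' ≫ φ)
  refine ⟨s ≫ φ + f ≫ ψ, ?_⟩
  rw [Preadditive.comp_add, ← reassoc_of% hk, hψ, ← Category.assoc, ← Category.assoc,
    ← Preadditive.add_comp, homotopy, Category.id_comp]

end Precovers

/-! ### Cutting exact sequences at kernels -/

section Cycles

variable {A : Type u} [Category.{v} A] [Abelian A]

/-- The sequence `ker f → B → ker g` attached to composable morphisms `f : B ⟶ C` and `g : C ⟶ D`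
with zero composition. -/
noncomputable def kernelSequence {B C D : A} (f : B ⟶ C) (g : C ⟶ D) (w : f ≫ g = 0) :
    ShortComplex A :=
  ShortComplex.mk (kernel.ι f) (kernel.lift g f w) (by
    rw [← cancel_mono (kernel.ι _)]
    simp)

/-- Corestricting `f` to a subobject of its target does not change its kernel. -/
lemma exact_kernelLift {B C D E : A} (e : B ⟶ C) (f : C ⟶ D) (g : D ⟶ E) (w : f ≫ g = 0)
    (zero : e ≫ f = 0) (h : (ShortComplex.mk e f zero).Exact) (zero' : e ≫ kernel.lift g f w = 0) :
    (ShortComplex.mk e (kernel.lift g f w) zero').Exact := by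
  let α : ShortComplex.mk e (kernel.lift g f w) zero' ⟶ ShortComplex.mk e f zero :=
    { τ₁ := 𝟙 B, τ₂ := 𝟙 C, τ₃ := kernel.ι g }
  have : Epi α.τ₁ := inferInstanceAs (Epi (𝟙 B))
  have : IsIso α.τ₂ := inferInstanceAs (IsIso (𝟙 C))
  have : Mono α.τ₃ := inferInstanceAs (Mono (kernel.ι g))
  exact (ShortComplex.exact_iff_of_epi_of_isIso_of_mono α).2 h

lemma shortExact_kernelSequence {B C D : A} (f : B ⟶ C) (g : C ⟶ D) (w : f ≫ g = 0)
    (h : (ShortComplex.mk f g w).Exact) : (kernelSequence f g w).ShortExact where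
  exact := exact_kernelLift _ f g w (kernel.condition _) (ShortComplex.exact_kernel _) _
  mono_f := inferInstanceAs (Mono (kernel.ι f))
  epi_g := (ShortComplex.exact_iff_epi_kernel_lift _).1 h

/-- For an exact sequence `B → C → D → E`, cocycles `C ⟶ N` are coboundaries if and only if
morphisms `ker (D ⟶ E) ⟶ N` extend to `D`. -/
lemma coboundary_iff_extension {B C D E : A} (e : B ⟶ C) (f : C ⟶ D) (g : D ⟶ E)
    (zero : e ≫ f = 0) (w : f ≫ g = 0) (h : (ShortComplex.mk e f zero).Exact)
    (h' : (ShortComplex.mk f g w).Exact) (N : A) :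
    (∀ φ : C ⟶ N, e ≫ φ = 0 → ∃ ψ : D ⟶ N, f ≫ ψ = φ) ↔
      ∀ φ : kernel g ⟶ N, ∃ ψ : D ⟶ N, kernel.ι g ≫ ψ = φ := by
  -- Exactness identifies the cokernel of `e` with `kernel g`, so cocycles on `C` are the same as
  -- maps out of `kernel g`.
  have hepi : Epi (kernel.lift g f w) := (ShortComplex.exact_iff_epi_kernel_lift _).1 h'
  have zero' : e ≫ kernel.lift g f w = 0 := by
    rw [← cancel_mono (kernel.ι g)]
    simpa
  constructor
  · intro H φ
    obtain ⟨ψ, hψ⟩ := H (kernel.lift g f w ≫ φ) (by rw [reassoc_of% zero', zero_comp])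
    refine ⟨ψ, ?_⟩
    rw [← cancel_epi (kernel.lift g f w), kernel.lift_ι_assoc, hψ]
  · intro H φ hφ
    have hex := exact_kernelLift e f g w zero h zero'
    have : Epi (ShortComplex.mk e (kernel.lift g f w) zero').g := hepi
    obtain ⟨ψ, hψ⟩ := H (hex.desc φ hφ)
    refine ⟨ψ, ?_⟩
    rw [← kernel.lift_ι g f w, Category.assoc, hψ]
    exact hex.g_desc φ hφ

lemma exists_lift_kernelLift {B C D E : A} (f : C ⟶ D) (g : D ⟶ E) (w : f ≫ g = 0)
    (h : ∀ t : B ⟶ D, t ≫ g = 0 → ∃ l : B ⟶ C, l ≫ f = t) (t : B ⟶ kernel g) :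
    ∃ l : B ⟶ C, l ≫ kernel.lift g f w = t := by
  obtain ⟨l, hl⟩ := h (t ≫ kernel.ι g) (by simp)
  refine ⟨l, ?_⟩
  rw [← cancel_mono (kernel.ι g), Category.assoc, kernel.lift_ι, hl]

/-- The kernel of a morphism that vanishes. -/
noncomputable def kernelIsoOfEqZero {B C : A} (f : B ⟶ C) (h : f = 0) : kernel f ≅ B where
  hom := kernel.ι f
  inv := kernel.lift f (𝟙 B) (by simp [h])
  hom_inv_id := by
    rw [← cancel_mono (kernel.ι f)]
    simp

end Cycles

/-! ### Relative resolutions as chains of precovers -/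

section Resolutions

variable {A : Type u} [Category.{v} A] [Abelian A]

/-- The short complex formed by the `(m + 1)`-st cycles of a chain complex, its degree `m + 1`
and its `m`-th cycles. -/
noncomputable def cyclesSequence (K : ChainComplex A ℕ) (m : ℕ) : ShortComplex A :=
  kernelSequence (K.d (m + 1) m) (K.d m (m - 1)) (K.d_comp_d _ _ _)

/-- Truncated subtraction matches the default successor of `0`, so the degree of the augmented
object needs no separate treatment. -/
lemma next_down_nat (m : ℕ) : (ComplexShape.down ℕ).next m = m - 1 := by
  cases m <;> simp

/-- The `0`-th cycles form the whole object in degree `0`. -/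
noncomputable def cyclesSequenceIso (K : ChainComplex A ℕ) : (cyclesSequence K 0).X₃ ≅ K.X 0 :=
  kernelIsoOfEqZero (K.d 0 (0 - 1)) (K.shape _ _ (by simp))

lemma shortExact_cyclesSequence {K : ChainComplex A ℕ} {m : ℕ} (h : K.ExactAt m) :
    (cyclesSequence K m).ShortExact := by
  rw [HomologicalComplex.exactAt_iff' _ (m + 1) m (m - 1) (by simp) (next_down_nat m)] at h
  exact shortExact_kernelSequence _ _ _ h

/-- Exactness of `Hom(K, N)` in terms of the cycles of an exact complex `K`. -/
lemma homFrom_exactAt_iff_extension {K : ChainComplex A ℕ} (hK : K.Acyclic) (N : A) (m : ℕ) :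
    (homFrom K N).ExactAt (m + 2) ↔ ∀ φ : (cyclesSequence K m).X₁ ⟶ N,
      ∃ ψ : (cyclesSequence K m).X₂ ⟶ N, (cyclesSequence K m).f ≫ ψ = φ := by
  -- For an augmented resolution, degree `m + 2` carries the `m + 1`-st relative Ext, and `m = 0` is
  -- the kernel of the augmentation.
  rw [homFrom_exactAt_iff K N (m + 3) (m + 2) (m + 1) (by simp) (by simp)]
  have h₁ := hK (m + 1)
  have h₂ := hK (m + 2)
  rw [HomologicalComplex.exactAt_iff' _ (m + 2) (m + 1) m (by simp) (by simp)] at h₁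
  rw [HomologicalComplex.exactAt_iff' _ (m + 3) (m + 2) (m + 1) (by simp) (by simp)] at h₂
  exact coboundary_iff_extension _ _ _ (K.d_comp_d _ _ _) (K.d_comp_d _ _ _) h₂ h₁ N

/-- The complexes `Hom(E, N)` of the deleted and the augmented complex agree in degrees at least
`1`. -/
lemma LeftAugmented.homFrom_exactAt_iff {M : A} (E : LeftAugmented M) (N : A) (m : ℕ) :
    (homFrom E.complex N).ExactAt (m + 1) ↔ (homFrom E.augmented N).ExactAt (m + 2) := by
  rw [CotorsionTriple.homFrom_exactAt_iff E.complex N (m + 2) (m + 1) m (by simp) (by simp),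
    CotorsionTriple.homFrom_exactAt_iff E.augmented N (m + 3) (m + 2) (m + 1) (by simp) (by simp)]
  rfl

variable [EnoughProjectives A] {X : ObjectProperty A}

/-- Projectives lie in `X`, and they detect absolute exactness. -/
lemma LeftAugmented.IsResolution.acyclic (hX : ∀ P : A, Projective P → X P) {M : A}
    {E : LeftAugmented M} (hE : E.IsResolution X) : E.augmented.Acyclic :=
  fun i => exactAt_of_homTo _ i fun P hP => hE.exact P (hX P hP) i

/-- Exactness of `Hom(B, -)` in degree `m` says precisely that maps from `B` to the `m`-th cycles
lift. -/
lemma LeftAugmented.IsResolution.isPrecoverSequence (hX : ∀ P : A, Projective P → X P) {M : A}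
    {E : LeftAugmented M} (hE : E.IsResolution X) (m : ℕ) :
    IsPrecoverSequence X (cyclesSequence E.augmented m) where
  shortExact := shortExact_cyclesSequence (hE.acyclic hX m)
  mem := hE.mem m
  exists_lift {B} hB f :=
    exists_lift_kernelLift _ _ (E.augmented.d_comp_d _ _ _)
      ((homTo_exactAt_iff B E.augmented (m + 1) m (m - 1) (by simp) (next_down_nat m)).1
        (hE.exact B hB m)) f

end Resolutions

/-! ### Coresolutions and their cokernels -/

section Coresolutions

variable {A : Type u} [Category.{v} A] [Abelian A]

section Existence

variable (app : A → A) (g : ∀ M : A, M ⟶ app M)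

/-- The iterated cokernels of chosen morphisms `g M : M ⟶ app M`. -/
noncomputable def cosyz (N : A) : ℕ → A
  | 0 => N
  | n + 1 => cokernel (g (cosyz N n))

/-- The projection onto the next iterated cokernel. -/
noncomputable def cosyzπ (N : A) (n : ℕ) : app (cosyz app g N n) ⟶ cosyz app g N (n + 1) :=
  cokernel.π (g (cosyz app g N n))

lemma comp_cosyzπ (N : A) (n : ℕ) : g (cosyz app g N n) ≫ cosyzπ app g N n = 0 :=
  cokernel.condition _

lemma cosyzπ_cancel (N : A) (n : ℕ) {B : A} (f : cosyz app g N (n + 1) ⟶ B)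
    (hf : cosyzπ app g N n ≫ f = 0) : f = 0 :=
  (cancel_epi (cokernel.π (g (cosyz app g N n)))).1 (hf.trans comp_zero.symm)

lemma exists_desc_cosyz (N : A) (n : ℕ) {B : A} (f : app (cosyz app g N n) ⟶ B)
    (hf : g (cosyz app g N n) ≫ f = 0) :
    ∃ l : cosyz app g N (n + 1) ⟶ B, cosyzπ app g N n ≫ l = f :=
  ⟨cokernel.desc _ f hf, cokernel.π_desc _ f hf⟩

/-- The complex obtained by splicing chosen morphisms `g M : M ⟶ app M` along their cokernels. -/
noncomputable def cosplice (N : A) : RightAugmented N where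
  complex := CochainComplex.of (fun n => app (cosyz app g N n))
    (fun n => cosyzπ app g N n ≫ g (cosyz app g N (n + 1)))
    (fun n => by
      rw [Category.assoc, ← Category.assoc (g (cosyz app g N (n + 1))), comp_cosyzπ, zero_comp,
        comp_zero])
  ι := g N
  zero := by
    have h := CochainComplex.of_d (fun n => app (cosyz app g N n))
      (fun n => cosyzπ app g N n ≫ g (cosyz app g N (n + 1))) 0
    refine (congrArg (fun t => g (cosyz app g N 0) ≫ t) h).trans ?_
    change g (cosyz app g N 0) ≫ cosyzπ app g N 0 ≫ g (cosyz app g N 1) = 0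
    rw [← Category.assoc, comp_cosyzπ, zero_comp]

lemma cosplice_d (N : A) (n : ℕ) :
    (cosplice app g N).complex.d n (n + 1) = cosyzπ app g N n ≫ g (cosyz app g N (n + 1)) :=
  CochainComplex.of_d (fun n => app (cosyz app g N n))
    (fun n => cosyzπ app g N n ≫ g (cosyz app g N (n + 1))) n

/-- Exactness of `Hom(K, Y)` in terms of morphisms. -/
lemma homFrom_acyclic (K : CochainComplex A ℕ) (Y : A)
    (h0 : ∀ f : K.X 0 ⟶ Y, ∃ g : K.X 1 ⟶ Y, K.d 0 1 ≫ g = f)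
    (h1 : ∀ (n : ℕ) (f : K.X (n + 1) ⟶ Y), K.d n (n + 1) ≫ f = 0 →
      ∃ g : K.X (n + 2) ⟶ Y, K.d (n + 1) (n + 2) ≫ g = f) :
    (homFrom K Y).Acyclic := by
  intro i
  cases i with
  | zero =>
    exact (homFrom_exactAt_iff K Y 0 0 1 (by simp) (by simp)).2 fun f _ => h0 f
  | succ n =>
    exact (homFrom_exactAt_iff K Y n (n + 1) (n + 2) (by simp) (by simp)).2 (h1 n)

lemma cosplice_exact (N Y : A) (h : ∀ (B : A) (f : B ⟶ Y), ∃ l : app B ⟶ Y, g B ≫ l = f) :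
    (homFrom (cosplice app g N).augmented Y).Acyclic := by
  have key (n : ℕ) (f : app (cosyz app g N n) ⟶ Y) (hf : g (cosyz app g N n) ≫ f = 0) :
      ∃ l : (cosplice app g N).complex.X (n + 1) ⟶ Y,
        (cosplice app g N).complex.d n (n + 1) ≫ l = f := by
    obtain ⟨k, hk⟩ := exists_desc_cosyz app g N n f hf
    obtain ⟨l, hl⟩ := h _ k
    refine ⟨l, (congrArg (fun t => t ≫ l) (cosplice_d app g N n)).trans ?_⟩
    change (cosyzπ app g N n ≫ g (cosyz app g N (n + 1))) ≫ l = f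
    rw [Category.assoc, hl, hk]
  refine homFrom_acyclic _ _ (h N) ?_
  intro n
  cases n with
  | zero =>
    intro f hf
    exact key 0 f hf
  | succ n =>
    intro f hf
    change app (cosyz app g N (n + 1)) ⟶ Y at f
    have hf' : (cosyzπ app g N n ≫ g (cosyz app g N (n + 1))) ≫ f = 0 :=
      (congrArg (fun t => t ≫ (show (cosplice app g N).complex.X (n + 1) ⟶ Y from f))
        (cosplice_d app g N n)).symm.trans hf
    exact key (n + 1) f (cosyzπ_cancel app g N n _ ((Category.assoc _ _ _).symm.trans hf'))

end Existence

/-- For a complete cotorsion pair `(P, Q)`, every object has a `Q`-coresolution. -/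
theorem exists_coresolution [HasExt.{w} A] {P Q : ObjectProperty A} (h : IsCotorsionPair.{w} P Q)
    (hc : IsCompletePair P Q) (N : A) : ∃ E : RightAugmented N, E.IsCoresolution Q := by
  choose I C f g zero hP hQ hS using hc.exists_right
  exact ⟨cosplice I f N, fun i => hQ _, fun Y hY => cosplice_exact I f N Y fun B t =>
    -- The cokernel of the chosen embedding is in `P`, so its `Ext¹` into `Y` vanishes.
    exists_extension (hS B) (h.subsingleton (hP B) hY) t⟩

/-- Injectives lie in `Q`, and they detect absolute exactness. -/
lemma RightAugmented.IsCoresolution.acyclic [EnoughInjectives A] {Q : ObjectProperty A}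
    (hQ : ∀ J : A, Injective J → Q J) {N : A} {E : RightAugmented N} (hE : E.IsCoresolution Q) :
    E.augmented.Acyclic :=
  fun i => exactAt_of_homFrom _ i fun J hJ => hE.exact J (hQ J hJ) i

/-- An exact sequence `B → C → D` yields a short exact sequence `0 → coker e → D → coker f → 0`. -/
lemma shortExact_cokernelSequence {B C D : A} (e : B ⟶ C) (f : C ⟶ D) (w : e ≫ f = 0)
    (h : (ShortComplex.mk e f w).Exact) :
    ∃ w' : cokernel.desc e f w ≫ cokernel.π f = 0,
      (ShortComplex.mk (cokernel.desc e f w) (cokernel.π f) w').ShortExact := by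
  have hw : cokernel.desc e f w ≫ cokernel.π f = 0 := by
    rw [← cancel_epi (cokernel.π e)]
    simp
  refine ⟨hw, ?_⟩
  let α : ShortComplex.mk f (cokernel.π f) (cokernel.condition f) ⟶
      ShortComplex.mk (cokernel.desc e f w) (cokernel.π f) hw :=
    { τ₁ := cokernel.π e, τ₂ := 𝟙 D, τ₃ := 𝟙 _ }
  have : Epi α.τ₁ := inferInstanceAs (Epi (cokernel.π e))
  have : IsIso α.τ₂ := inferInstanceAs (IsIso (𝟙 D))
  have : Mono α.τ₃ := inferInstanceAs (Mono (𝟙 _))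
  exact
    { exact := (ShortComplex.exact_iff_of_epi_of_isIso_of_mono α).1 (ShortComplex.exact_cokernel f)
      mono_f := (ShortComplex.exact_iff_mono_cokernel_desc _).1 h
      epi_g := inferInstanceAs (Epi (cokernel.π f)) }

/-- The short exact sequences `0 → Lʲ → Yʲ → Lʲ⁺¹ → 0` of an exact sequence
`0 → N → Y⁰ → Y¹ → ⋯`. -/
lemma RightAugmented.exists_shortExact_nthCokernel {N : A} (E : RightAugmented N)
    (hE : E.augmented.Acyclic) (j : ℕ) :
    ∃ (f : E.nthCokernel j ⟶ E.complex.X j) (g : E.complex.X j ⟶ E.nthCokernel (j + 1))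
      (zero : f ≫ g = 0), (ShortComplex.mk f g zero).ShortExact := by
  have h := hE j
  cases j with
  | zero =>
    rw [HomologicalComplex.exactAt_iff' _ 0 0 1 (by simp) (by simp)] at h
    have : Mono E.ι := (ShortComplex.exact_iff_mono _ (E.augmented.shape 0 0 (by simp))).1 h
    exact ⟨E.ι, cokernel.π E.ι, cokernel.condition _,
      { exact := ShortComplex.exact_cokernel _
        mono_f := this
        epi_g := inferInstanceAs (Epi (cokernel.π E.ι)) }⟩
  | succ j =>
    rw [HomologicalComplex.exactAt_iff' _ j (j + 1) (j + 2) (by simp) (by simp)] at h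
    obtain ⟨w, hw⟩ := shortExact_cokernelSequence _ _ _ h
    -- The split only unfolds `nthCokernel`, whose clauses differ at `1` and from `2` on.
    cases j with
    | zero => exact ⟨_, _, w, hw⟩
    | succ j => exact ⟨_, _, w, hw⟩

/-- Each step along the coresolution trades one cokernel index for one Ext degree. -/
lemma RightAugmented.subsingleton_ext_nthCokernel_iff [HasExt.{w} A] {N : A}
    (E : RightAugmented N) (hE : E.augmented.Acyclic) (M : A)
    (hM : ∀ j i : ℕ, Subsingleton (Ext.{w} M (E.complex.X j) (i + 1))) (j i : ℕ) :
    Subsingleton (Ext.{w} M (E.nthCokernel j) (i + 1)) ↔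
      Subsingleton (Ext.{w} M N (j + (i + 1))) := by
  induction j generalizing i with
  | zero =>
    rw [zero_add]
    rfl
  | succ j ih =>
    obtain ⟨f, g, zero, hS⟩ := E.exists_shortExact_nthCokernel hE j
    rw [show j + 1 + (i + 1) = j + (i + 1 + 1) by lia, ← ih]
    exact subsingleton_ext_iff_of_shortExact hS M (i + 1) (hM j i) (hM j (i + 1))

/-- For a hereditary cotorsion pair `(P, Q)` and an exact coresolution of `N` by objects of `Q`, the
`n`-th cokernel lies in `Q` if and only if `Ext^{n+i}(P, N) = 0` for `i ≥ 1`. -/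
lemma RightAugmented.nthCokernel_mem_iff [HasExt.{w} A] [EnoughProjectives A]
    {P Q : ObjectProperty A} (h : IsCotorsionPair.{w} P Q) (hP : IsResolving P) {N : A}
    (E : RightAugmented N) (hE : E.augmented.Acyclic) (hQ : ∀ i, Q (E.complex.X i)) (n : ℕ) :
    Q (E.nthCokernel n) ↔
      ∀ (M : A) (i : ℕ), P M → 1 ≤ i → Subsingleton (Ext.{w} M N (n + i)) := by
  have key (M : A) (hM : P M) := E.subsingleton_ext_nthCokernel_iff hE M fun j i =>
    h.subsingleton_succ hP hM (hQ j) i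
  constructor
  · intro hn M i hM hi
    obtain ⟨i, rfl⟩ := Nat.exists_eq_add_of_le' hi
    exact (key M hM n i).1 (h.subsingleton_succ hP hM hn i)
  · intro H
    rw [h.right_eq]
    intro M hM
    exact (key M hM n 0).2 (H M 1 hM le_rfl)

end Coresolutions

/-! ### Relative injective dimension -/

section RelInjDim

variable {A : Type u} [Category.{v} A] [Abelian A] [HasExt.{w} A]

lemma relInjDim_le_iff (C : ObjectProperty A) (N : A) (n : ℕ) :
    relInjDim.{w} C N ≤ n ↔
      ∀ (M : A) (i : ℕ), C M → 1 ≤ i → Subsingleton (Ext.{w} M N (n + i)) := by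
  constructor
  · intro h M i hM hi
    -- Weakening `≤ n` to `< n + 1` yields an actual bound `m ≤ n` from the infimum.
    obtain ⟨d, ⟨m, rfl, hm⟩, hd⟩ := sInf_lt_iff.1
      (lt_of_le_of_lt h (ENat.natCast_lt_natCast.2 (Nat.lt_succ_self n)))
    have hmn : m ≤ n := Nat.lt_succ_iff.1 (ENat.natCast_lt_natCast.1 hd)
    rw [show n + i = m + (n - m + i) by lia]
    exact hm M _ hM (by lia)
  · exact fun h => sInf_le ⟨n, rfl, h⟩

end RelInjDim

/-! ### Dimension shifting for relative Ext -/

section Shift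

variable {A : Type u} [Category.{v} A] [Abelian A]

/-- Dimension shifting for `Hom(K, -)` along a short exact sequence that stays exact under
`Hom(Kᵢ, -)`. -/
lemma homFrom_exactAt_shift (K : ChainComplex A ℕ) {S : ShortComplex A} (hS : S.ShortExact)
    (lift : ∀ (i : ℕ) (f : K.X i ⟶ S.X₃), ∃ g : K.X i ⟶ S.X₂, g ≫ S.g = f) (m : ℕ)
    (h₁ : (homFrom K S.X₂).ExactAt (m + 1)) (h₂ : (homFrom K S.X₂).ExactAt (m + 2)) :
    (homFrom K S.X₁).ExactAt (m + 2) ↔ (homFrom K S.X₃).ExactAt (m + 1) := by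
  have := hS.mono_f
  rw [homFrom_exactAt_iff K _ (m + 2) (m + 1) m (by simp) (by simp)] at h₁ ⊢
  rw [homFrom_exactAt_iff K _ (m + 3) (m + 2) (m + 1) (by simp) (by simp)] at h₂ ⊢
  constructor
  · intro H φ hφ
    obtain ⟨φ', rfl⟩ := lift _ φ
    -- `θ` represents the connecting image of the cocycle; a primitive of it corrects `φ'` to a
    -- cocycle.
    let θ := hS.exact.lift (K.d (m + 2) (m + 1) ≫ φ') (by simpa using hφ)
    have hθ : θ ≫ S.f = K.d (m + 2) (m + 1) ≫ φ' := hS.exact.lift_f _ _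
    obtain ⟨ψ, hψ⟩ := H θ (by rw [← cancel_mono S.f]; simp [hθ])
    obtain ⟨χ, hχ⟩ := h₁ (φ' - ψ ≫ S.f) (by simp [← hθ, reassoc_of% hψ])
    exact ⟨χ ≫ S.g, by simp [reassoc_of% hχ]⟩
  · intro H θ hθ
    obtain ⟨χ, hχ⟩ := h₂ (θ ≫ S.f) (by rw [reassoc_of% hθ, zero_comp])
    obtain ⟨η, hη⟩ := H (χ ≫ S.g) (by simp [reassoc_of% hχ])
    obtain ⟨η', rfl⟩ := lift _ η
    -- Subtracting a coboundary moves the primitive `χ` into the kernel `S.X₁`.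
    let ψ := hS.exact.lift (χ - K.d (m + 1) m ≫ η') (by simp [hη])
    have hψ : ψ ≫ S.f = χ - K.d (m + 1) m ≫ η' := hS.exact.lift_f _ _
    exact ⟨ψ, by rw [← cancel_mono S.f]; simp [hψ, hχ]⟩

end Shift

/-! ### Comparing relative and absolute Ext -/

section Triple

variable {A : Type u} [Category.{v} A] [Abelian A] [HasExt.{w} A] {X Z Y : ObjectProperty A}
  (h : IsCompleteHereditaryCotorsionTriple.{w} X Z Y)

include h

/-- Projective presentations of objects of `Z` are `X`-precovers. -/
lemma IsCompleteHereditaryCotorsionTriple.isPrecoverSequence_of_projective {S : ShortComplex A}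
    (hS : S.ShortExact) (hproj : Projective S.X₂) (hZ : Z S.X₃) : IsPrecoverSequence X S where
  shortExact := hS
  mem := h.hereditary_left.projective _ hproj
  -- `Z` is resolving, so the kernel is in `Z` and is orthogonal to `X`.
  exists_lift hX f := exists_lifting hS (h.left.subsingleton hX
    ((h.hereditary_right.mem_iff S hS hZ).1 (h.hereditary_right.projective _ hproj))) f

variable [EnoughProjectives A]

/-- A short exact sequence ending in `Z` stays exact under `Hom(B, -)` for `B` in `X`. -/
lemma IsCompleteHereditaryCotorsionTriple.exists_lift {S : ShortComplex A} (hS : S.ShortExact)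
    (hZ : Z S.X₃) {B : A} (hB : X B) (f : B ⟶ S.X₃) : ∃ g : B ⟶ S.X₂, g ≫ S.g = f := by
  obtain ⟨T, hT, hproj, hST⟩ := exists_shortExact_projective S.X₃
  have := hS.epi_g
  have hTZ : Z T.X₃ := by rwa [hST]
  -- First lift `f` to the projective covering `S.X₃`; projectivity then carries it into `S.X₂`.
  obtain ⟨t, ht⟩ := (h.isPrecoverSequence_of_projective hT hproj hTZ).exists_lift hB
    (f ≫ eqToHom hST.symm)
  exact ⟨t ≫ Projective.factorThru (T.g ≫ eqToHom hST) S.g, by simp [reassoc_of% ht]⟩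

/-- For `M` in `Z`, the first relative extension group of `M` controls `Ext¹(M, -)`. -/
lemma IsCompleteHereditaryCotorsionTriple.subsingleton_ext_one {M : A} {E : LeftAugmented M}
    (hE : E.IsResolution X) (hM : Z M) {N : A} (hN : (homFrom E.complex N).ExactAt 1) :
    Subsingleton (Ext.{w} M N 1) := by
  have hX := h.hereditary_left.projective
  rw [E.homFrom_exactAt_iff, homFrom_exactAt_iff_extension (hE.acyclic hX)] at hN
  obtain ⟨S, hS, hproj, rfl⟩ := exists_shortExact_projective M
  exact subsingleton_ext_one_of_extension hS (subsingleton_of_forall_eq 0 Ext.eq_zero_of_projective)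
    ((h.isPrecoverSequence_of_projective hS hproj hM).exists_extension
      (hE.isPrecoverSequence hX 0) (cyclesSequenceIso E.augmented).symm hN)

variable [EnoughInjectives A]

/-- Morphisms from the kernel of an `X`-precover to objects of `Y` extend. -/
lemma IsCompleteHereditaryCotorsionTriple.exists_extension {S : ShortComplex A}
    (hS : IsPrecoverSequence X S) {N : A} (hN : Y N) (φ : S.X₁ ⟶ N) :
    ∃ ψ : S.X₂ ⟶ N, S.f ≫ ψ = φ := by
  obtain ⟨K, B, f, g, zero, hB, hK, hT⟩ := h.complete_left.exists_left S.X₃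
  have hT' : IsPrecoverSequence X (ShortComplex.mk f g zero) :=
    ⟨hT, hB, fun hC t => exists_lifting hT (h.left.subsingleton hC hK) t⟩
  refine hS.exists_extension hT' (Iso.refl _) (fun φ => ?_) φ
  -- The injective lies in `Z`, and so does its quotient by `K`; hence `φ` extends over the
  -- injective, to which `B` maps.
  have hI : (ShortComplex.mk (Injective.ι K) (cokernel.π _) (cokernel.condition _)).ShortExact :=
    { exact := ShortComplex.exact_cokernel _ }
  obtain ⟨ψ, hψ⟩ := CotorsionTriple.exists_extension hI (h.right.subsingleton
    (h.left.right_of_shortExact h.hereditary_left hI hK (h.left.right_of_injective _)) hN) φ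
  have := hT.mono_f
  refine ⟨Injective.factorThru (Injective.ι K) f ≫ ψ, ?_⟩
  exact (Injective.comp_factorThru_assoc _ _ _).trans hψ

lemma IsCompleteHereditaryCotorsionTriple.homFrom_exactAt {M : A} {E : LeftAugmented M}
    (hE : E.IsResolution X) {N : A} (hN : Y N) (m : ℕ) :
    (homFrom E.complex N).ExactAt (m + 1) := by
  have hX := h.hereditary_left.projective
  rw [E.homFrom_exactAt_iff, homFrom_exactAt_iff_extension (hE.acyclic hX)]
  exact h.exists_extension (hE.isPrecoverSequence hX m) hN

/-- Vanishing of the relative extension groups in degrees above `n` is equivalent to vanishing of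
`Ext^{n+i}(Z, -)` for `i ≥ 1`. -/
lemma IsCompleteHereditaryCotorsionTriple.forall_exactAt_iff (E : ∀ M : A, LeftAugmented M)
    (hE : ∀ M, (E M).IsResolution X) (n : ℕ) (N : A) :
    (∀ (M : A) (i : ℕ), 1 ≤ i → (homFrom (E M).complex N).ExactAt (n + i)) ↔
      ∀ (M : A) (i : ℕ), Z M → 1 ≤ i → Subsingleton (Ext.{w} M N (n + i)) := by
  induction n generalizing N with
  | zero =>
    simp only [zero_add]
    have hext (H : ∀ M, Z M → Subsingleton (Ext.{w} M N 1)) : Y N := by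
      rw [h.right.right_eq]
      exact H
    constructor
    · intro H M i hM hi
      obtain ⟨i, rfl⟩ := Nat.exists_eq_add_of_le' hi
      exact h.right.subsingleton_succ h.hereditary_right hM
        (hext fun B hB => h.subsingleton_ext_one (hE B) hB (H B 1 le_rfl)) i
    · intro H M i hi
      obtain ⟨i, rfl⟩ := Nat.exists_eq_add_of_le' hi
      exact h.homFrom_exactAt (hE M) (hext fun B hB => H B 1 hB le_rfl) i
  | succ n ih =>
    -- Taking `L` in `Z` keeps the sequence exact under `Hom(B, -)` for `B` in `X`; taking `I` in
    -- `Y` kills both theories in positive degrees.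
    obtain ⟨I, L, f, g, zero, hL, hI, hS⟩ := h.complete_right.exists_right N
    have h₁ (M : A) (i : ℕ) :
        (homFrom (E M).complex N).ExactAt (n + 1 + (i + 1)) ↔
          (homFrom (E M).complex L).ExactAt (n + (i + 1)) := by
      rw [show n + 1 + (i + 1) = n + i + 2 by lia]
      exact homFrom_exactAt_shift _ hS (fun j t => h.exists_lift hS hL ((hE M).mem j) t) (n + i)
        (h.homFrom_exactAt (hE M) hI _) (h.homFrom_exactAt (hE M) hI _)
    have h₂ (M : A) (hM : Z M) (i : ℕ) :
        Subsingleton (Ext.{w} M L (n + (i + 1))) ↔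
          Subsingleton (Ext.{w} M N (n + 1 + (i + 1))) := by
      rw [show n + 1 + (i + 1) = n + (i + 1) + 1 by lia]
      exact subsingleton_ext_iff_of_shortExact hS M (n + (i + 1))
        (h.right.subsingleton_succ h.hereditary_right hM hI _)
        (h.right.subsingleton_succ h.hereditary_right hM hI _)
    refine Iff.trans ?_ ((ih L).trans ?_)
    · refine forall_congr' fun M => forall_congr' fun i => forall_congr' fun hi => ?_
      obtain ⟨i, rfl⟩ := Nat.exists_eq_add_of_le' hi
      exact h₁ M i
    · refine forall_congr' fun M => forall_congr' fun i => forall_congr' fun hM =>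
        forall_congr' fun hi => ?_
      obtain ⟨i, rfl⟩ := Nat.exists_eq_add_of_le' hi
      exact h₂ M hM i

end Triple

end CotorsionTriple

theorem theorem4p7 {A : Type u} [Category.{v} A] [Abelian A] [EnoughProjectives A]
    [EnoughInjectives A] [HasExt.{w} A] {X Z Y : ObjectProperty A}
    (h : CotorsionTriple.IsCompleteHereditaryCotorsionTriple.{w} X Z Y) (N : A) (n : ℕ) :
    List.TFAE [
      CotorsionTriple.relInjDim.{w} Z N ≤ n,
      ∀ (Z' : A) (i : ℕ), Z Z' → 1 ≤ i → Subsingleton (Ext.{w} Z' N (n + i)),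
      ∀ (M : A) (i : ℕ), 1 ≤ i → IsZero (CotorsionTriple.relExt.{w} h M N (n + i)),
      ∀ E : CotorsionTriple.RightAugmented N, E.IsCoresolution Y → Y (E.nthCokernel n),
      ∀ E : CotorsionTriple.RightAugmented N, E.augmented.Acyclic →
        (∀ i : ℕ, Y (E.complex.X i)) → Y (E.nthCokernel n)] := by
  have acyclic (E : CotorsionTriple.RightAugmented N) (hE : E.IsCoresolution Y) :
      E.augmented.Acyclic :=
    hE.acyclic fun J _ => h.right.right_of_injective J
  tfae_have 1 ↔ 2 := CotorsionTriple.relInjDim_le_iff Z N n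
  tfae_have 3 ↔ 2 := by
    -- The comparison holds for any family of resolutions, in particular the one chosen in `relExt`.
    rw [← h.forall_exactAt_iff _ (fun M =>
      (CotorsionTriple.exists_resolution h.left h.complete_left M).choose_spec) n N]
    simp only [HomologicalComplex.exactAt_iff_isZero_homology]
    rfl
  tfae_have 2 → 5 := fun H E hE hY =>
    (E.nthCokernel_mem_iff h.right h.hereditary_right hE hY n).2 H
  tfae_have 5 → 4 := fun H E hE => H E (acyclic E hE) hE.mem
  tfae_have 4 → 2 := by
    intro H
    -- Completeness supplies a coresolution, so the universal condition is not vacuous.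
    obtain ⟨E, hE⟩ := CotorsionTriple.exists_coresolution h.right h.complete_right N
    exact (E.nthCokernel_mem_iff h.right h.hereditary_right (acyclic E hE) hE.mem n).1 (H E hE)
  tfae_finish
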